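/- Conventions. A site $(\mathcal C,J)$ is a locally small category $\mathcal C$ with a Grothendieck topology $J$; it is *small generated* if there is a small set of objects of $\mathcal C$ such that every object has a $J$-covering sieve generated by arrows whose domains lie in this set (i.e. $\mathcal C$ has a small $J$-dense subcategory). Write $\mathrm{Sh}(\mathcal C,J)$ for the category of sheaves of sets, $y$ for the Yoneda embedding, $\mathfrak a_J$ for the associated sheaf functor. A *geometric morphism* $f:\mathcal E\to\mathcal F$ is an adjunction $f^*\dashv f_*$, $f^*:\mathcal F\to\mathcal E$, with $f^*$ preserving finite limits; a morphism $f\Rightarrow g$ of geometric morphisms is a natural transformation $f^*\Rightarrow g^*$. A *distributor* $H:\mathcal C\looparrowright\mathcal D$ is a functor $H:\mathcal D^{\mathrm{op}}\times\mathcal C\to\mathbf{Set}$, equivalently a functor $\widehat H:\mathcal C\to[\mathcal D^{\mathrm{op}},\mathbf{Set}]$, $c\mapsto H(-,c)$; morphisms are natural transformations. Let $(\mathcal C,J)$, $(\mathcal D,K)$ be sites. A distributor $H:\mathcal C\looparrowright\mathcal D$ is a *distributor of sites* $(\mathcal C,J)\looparrowright(\mathcal D,K)$ if it is (a) *cover-distributing*: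 for all $x\in H(d,c)$ and all $S\in J(c)$, the sieve of those $v:d'\to d$ for which there are $u:c'\to c$ in $S$ and $x'\in H(d',c')$ with $H(v,c)(x)=H(d',u)(x')$ is in $K(d)$; and (b) *$K$-flat*: (1) for each $d$, the sieve $\{v:d'\to d\mid \exists c,\ H(d',c)\neq\emptyset\}$ is in $K(d)$; (2) for all $x\in H(d,c)$, $x'\in H(d,c')$, the sieve of those $v:d'\to d$ for which there are $u:c''\to c$, $u':c''\to c'$ and $x''\in H(d',c'')$ with $H(d',u)(x'')=H(v,c)(x)$ and $H(d',u')(x'')=H(v,c')(x')$ is in $K(d)$; (3) for all $u,u':c'\rightrightarrows c$ and $x\in H(d,c')$ with $H(d,u)(x)=H(d,u')(x)$, the sieve of those $v:d'\to d$ for which there are $w:c''\to c'$ with $uw=u'w$ and $x'\in H(d',c'')$ with $H(d',w)(x')=H(v,c')(x)$ is in $K(d)$. It is *continuous* if moreover each presheaf $\widehat H(c)=H(-,c)$ is a $K$-sheaf. Continuous distributors of sites, with all natural transformations, form a category $\mathbf{Site}_{\mathrm{Cont}}[(\mathcal C,J),(\mathcal D,K)]$. A geometric morphism $f:\mathrm{Sh}(\mathcal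 D,K)\to\mathrm{Sh}(\mathcal C,J)$ is *induced by* $H$, written $f\simeq\mathrm{Sh}(H)$, if $f^*\mathfrak a_J$ is a left Kan extension of $\mathfrak a_K\widehat H:\mathcal C\to\mathrm{Sh}(\mathcal D,K)$ along $y:\mathcal C\to[\mathcal C^{\mathrm{op}},\mathbf{Set}]$ (equivalently, when $\mathcal C$ is small, $f^*\mathfrak a_J\simeq\mathfrak a_K\,\mathrm{Lan}_{y}\widehat H$). **Theorem.** For all small generated sites $(\mathcal C,J)$ and $(\mathcal D,K)$ there is an equivalence of categories $$\mathbf{Top}[\mathrm{Sh}(\mathcal D,K),\mathrm{Sh}(\mathcal C,J)]\;\simeq\;\mathbf{Site}_{\mathrm{Cont}}[(\mathcal C,J),(\mathcal D,K)],$$ which, up to natural isomorphism, sends $f$ to the distributor $H_f$ given by $H_f(d,c)=f^*(\mathfrak a_J y_c)(d)$, and whose inverse sends each $H$ to a geometric morphism $\mathrm{Sh}(H)$ induced by $H$. In particular, every geometric morphism $f:\mathrm{Sh}(\mathcal D,K)\to\mathrm{Sh}(\mathcal C,J)$ is induced by the continuous distributor of sites $H_f$, and any continuous distributor of sites inducing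 $f$ is isomorphic to $H_f$. -/

import Mathlib

open CategoryTheory Opposite Limits

universe v u₁ u₂

namespace CategoryTheory

section SmallGenerated

variable {C : Type u₁} [Category.{v} C]

/-- A site `(C, J)` (with `C` locally small) is small generated if it has a small `J`-dense
subcategory, i.e. there is a small family of objects such that every object of `C` has a
`J`-covering sieve generated by arrows whose domains belong to the family. (The full subcategory
on these objects is then `J`-dense; conversely the full subcategory on the objects of any small
`J`-dense subcategory is of this form.) -/
class GrothendieckTopology.IsSmallGenerated (J : GrothendieckTopology C) : Prop where
  exists_small_dense : ∃ P : ObjectProperty C, ObjectProperty.Small.{v} P ∧ P.ι.IsCoverDense J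

/-- Presheaves of sets on a small generated site have an associated sheaf. -/
instance (J : GrothendieckTopology C) [hJ : J.IsSmallGenerated] : HasSheafify J (Type v) := by
  obtain ⟨P, hP, hd⟩ := hJ.exists_small_dense
  have : EssentiallySmall.{v} P.FullSubcategory := by
    rw [essentiallySmall_iff]
    exact ⟨inferInstance, inferInstance⟩
  let G : SmallModel.{v} P.FullSubcategory ⥤ C :=
    (equivSmallModel.{v} P.FullSubcategory).inverse ⋙ P.ι
  have : G.Full := by dsimp only [G]; infer_instance
  have : G.Faithful := by dsimp only [G]; infer_instance
  have : G.IsCoverDense J := by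
    constructor
    intro X
    refine J.superset_covering ?_ (P.ι.is_cover_of_isCoverDense J X)
    rintro Y f ⟨⟨Z, g, h, rfl⟩⟩
    let i := (equivSmallModel.{v} P.FullSubcategory).unitIso.app Z
    exact ⟨⟨(equivSmallModel.{v} P.FullSubcategory).functor.obj Z, g ≫ P.ι.map i.hom,
      P.ι.map i.inv ≫ h, by simp⟩⟩
  exact Functor.IsDenseSubsite.hasSheafify_of_isEquivalence (G.inducedTopology J) J G

end SmallGenerated

section GeometricMorphism

/-- A geometric morphism `E → F`: a left exact functor `F ⥤ E` (the inverse image) together with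
a right adjoint (the direct image). -/
structure GeometricMorphism (E : Type*) [Category* E] (F : Type*) [Category* F] where
  inverseImage : F ⥤ E
  directImage : E ⥤ F
  adj : inverseImage ⊣ directImage
  preservesFiniteLimits : PreservesFiniteLimits inverseImage

namespace GeometricMorphism

variable {E : Type*} [Category* E] {F : Type*} [Category* F]

/-- Morphisms `f ⟶ g` of geometric morphisms are the natural transformations `f^* ⟶ g^*`. -/
instance : Category (GeometricMorphism E F) where
  Hom f g := f.inverseImage ⟶ g.inverseImage
  id f := 𝟙 f.inverseImage
  comp α β := NatTrans.vcomp α β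

variable (E F) in
/-- The functor sending a geometric morphism to its inverse image. -/
@[simps]
def inverseImageFunctor : GeometricMorphism E F ⥤ (F ⥤ E) where
  obj f := f.inverseImage
  map α := α

end GeometricMorphism

end GeometricMorphism

/-! A distributor `H : C ⇸ D` is a functor `Dᵒᵖ × C ⥤ Type v`, given in curried form
`C ⥤ Dᵒᵖ ⥤ Type v` (its classifying functor); this is `Profunctor C D`. The set `H(d, c)` is
`(H.obj c).obj (op d)`. -/

namespace Profunctor

variable {C : Type u₁} [Category.{v} C] {D : Type u₂} [Category.{v} D]

/-- For `x ∈ H(d, c)` and a sieve `S` on `c`, the sieve `x^* H[S]` on `d`: all `v : d' ⟶ d` for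
which there are `u' : c' ⟶ c` in `S` and `x' ∈ H(d', c')` with `H(v, c)(x) = H(d', u')(x')`. -/
def pullbackSieve (H : Profunctor.{v} C D) {c : C} {d : D} (x : (H.obj c).obj (op d))
    (S : Sieve c) : Sieve d where
  arrows d' v := ∃ (c' : C) (u' : c' ⟶ c) (x' : (H.obj c').obj (op d')),
    S u' ∧ (H.obj c).map v.op x = (H.map u').app (op d') x'
  downward_closed := by
    rintro d' d'' v ⟨c', u', x', hu, h⟩ w
    refine ⟨c', u', (H.obj c').map w.op x', hu, ?_⟩
    rw [op_comp, Functor.map_comp_apply, h, NatTrans.naturality_apply]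

/-- `H` is cover-distributing from `J` to `K`. -/
def IsCoverDistributing (J : GrothendieckTopology C) (K : GrothendieckTopology D)
    (H : Profunctor.{v} C D) : Prop :=
  ∀ ⦃c : C⦄ ⦃d : D⦄ (x : (H.obj c).obj (op d)) (S : Sieve c), S ∈ J c →
    H.pullbackSieve x S ∈ K d

/-- The arrows `v : d' ⟶ d` such that `H(d', c)` is nonempty for some `c`. -/
def nonemptySieve (H : Profunctor.{v} C D) (d : D) : Sieve d where
  arrows d' _ := ∃ c : C, Nonempty ((H.obj c).obj (op d'))
  downward_closed := by
    rintro d' d'' v ⟨c, ⟨x⟩⟩ w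
    exact ⟨c, ⟨(H.obj c).map w.op x⟩⟩

/-- For `x ∈ H(d, c)` and `x' ∈ H(d, c')`, the arrows `v : d' ⟶ d` along which `x` and `x'` both
factor through a common heteromorphism `x'' ∈ H(d', c'')`. -/
def spanSieve (H : Profunctor.{v} C D) {c c' : C} {d : D} (x : (H.obj c).obj (op d))
    (x' : (H.obj c').obj (op d)) : Sieve d where
  arrows d' v := ∃ (c'' : C) (u : c'' ⟶ c) (u' : c'' ⟶ c') (x'' : (H.obj c'').obj (op d')),
    (H.map u).app (op d') x'' = (H.obj c).map v.op x ∧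
    (H.map u').app (op d') x'' = (H.obj c').map v.op x'
  downward_closed := by
    rintro d' d'' v ⟨c'', u, u', x'', h, h'⟩ w
    refine ⟨c'', u, u', (H.obj c'').map w.op x'', ?_, ?_⟩
    · rw [op_comp, Functor.map_comp_apply, ← h, NatTrans.naturality_apply]
    · rw [op_comp, Functor.map_comp_apply, ← h', NatTrans.naturality_apply]

/-- For `u, u' : c' ⟶ c` and `x ∈ H(d, c')`, the arrows `v : d' ⟶ d` along which `x` factors
through some `w : c'' ⟶ c'` with `u w = u' w`. -/
def equalizerSieve (H : Profunctor.{v} C D) {c c' : C} (u u' : c' ⟶ c) {d : D}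
    (x : (H.obj c').obj (op d)) : Sieve d where
  arrows d' v := ∃ (c'' : C) (w : c'' ⟶ c') (x' : (H.obj c'').obj (op d')),
    w ≫ u = w ≫ u' ∧ (H.map w).app (op d') x' = (H.obj c').map v.op x
  downward_closed := by
    rintro d' d'' v ⟨c'', w, x', hw, h⟩ t
    refine ⟨c'', w, (H.obj c'').map t.op x', hw, ?_⟩
    rw [op_comp, Functor.map_comp_apply, ← h, NatTrans.naturality_apply]

/-- `H` is `K`-flat. -/
structure IsCoverFlat (K : GrothendieckTopology D) (H : Profunctor.{v} C D) : Prop where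
  nonempty_mem : ∀ d : D, H.nonemptySieve d ∈ K d
  span_mem : ∀ ⦃c c' : C⦄ ⦃d : D⦄ (x : (H.obj c).obj (op d)) (x' : (H.obj c').obj (op d)),
    H.spanSieve x x' ∈ K d
  equalizer_mem : ∀ ⦃c c' : C⦄ (u u' : c' ⟶ c) ⦃d : D⦄ (x : (H.obj c').obj (op d)),
    (H.map u).app (op d) x = (H.map u').app (op d) x → H.equalizerSieve u u' x ∈ K d

/-- `H` is a distributor of sites `(C, J) ⇸ (D, K)`. -/
structure IsDistributorOfSites (J : GrothendieckTopology C) (K : GrothendieckTopology D)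
    (H : Profunctor.{v} C D) : Prop where
  coverDistributing : H.IsCoverDistributing J K
  coverFlat : H.IsCoverFlat K

/-- `H` is a continuous distributor of sites: a distributor of sites such that each presheaf
`H(-, c)` is a `K`-sheaf. -/
structure IsContinuousDistributorOfSites (J : GrothendieckTopology C)
    (K : GrothendieckTopology D) (H : Profunctor.{v} C D) : Prop
    extends H.IsDistributorOfSites J K where
  isSheaf : ∀ c : C, Presheaf.IsSheaf K (H.obj c)

end Profunctor

section

variable {C : Type u₁} [Category.{v} C] {D : Type u₂} [Category.{v} D]
  (J : GrothendieckTopology C) (K : GrothendieckTopology D)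

/-- The category of continuous distributors of sites `(C, J) ⇸ (D, K)` and all transformations
of distributors between them. -/
abbrev ContinuousDistributor :=
  ObjectProperty.FullSubcategory
    (fun H : Profunctor.{v} C D => H.IsContinuousDistributorOfSites J K)

/-- The inclusion of continuous distributors of sites into all distributors. -/
abbrev ContinuousDistributor.ι : ContinuousDistributor J K ⥤ Profunctor.{v} C D :=
  ObjectProperty.ι _

/-- The functor `f ↦ H_f` from geometric morphisms `Sh(D, K) → Sh(C, J)` to distributors, where
`H_f(d, c) = f^*(a_J y_c)(d)`, with `y` the Yoneda embedding and `a_J` the associated sheaf. -/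
noncomputable def GeometricMorphism.toDistributor [J.IsSmallGenerated] :
    GeometricMorphism (Sheaf K (Type v)) (Sheaf J (Type v)) ⥤ Profunctor.{v} C D :=
  GeometricMorphism.inverseImageFunctor _ _ ⋙
    (Functor.whiskeringLeft _ _ _).obj (yoneda ⋙ presheafToSheaf J (Type v)) ⋙
    (Functor.whiskeringRight _ _ _).obj (sheafToPresheaf K (Type v))

/-- `f : Sh(D, K) → Sh(C, J)` is the geometric morphism `Sh(H)` induced by the distributor `H`
(up to isomorphism): `f^* a_J` is `a_K` composed with the left extension of `H` along the Yoneda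
embedding. The extension is formed in `K`-sheaves, as the left Kan extension of `a_K H` along
Yoneda: this is the same as `a_K` of the left Kan extension of `H` in presheaves when the latter
exists, but if `C` is not small the latter might not exist. -/
def Profunctor.Induces {J : GrothendieckTopology C} {K : GrothendieckTopology D}
    [J.IsSmallGenerated] [K.IsSmallGenerated] (H : Profunctor.{v} C D)
    (f : GeometricMorphism (Sheaf K (Type v)) (Sheaf J (Type v))) : Prop :=
  ∃ α : H ⋙ presheafToSheaf K (Type v) ⟶
      yoneda ⋙ (presheafToSheaf J (Type v) ⋙ f.inverseImage),
    (presheafToSheaf J (Type v) ⋙ f.inverseImage).IsLeftKanExtension α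

end

end CategoryTheory

/-! ## Left exact cocontinuous functors on presheaves -/

namespace CategoryTheory

section Cocontinuous

variable {C : Type u₁} [Category.{v} C] {E : Type*} [Category* E]

/-! The functor `f ↦ H_f` is shown to be fully faithful and essentially surjective onto continuous
distributors of sites.

Full faithfulness: `f^* a_J` is cocontinuous, hence the left Kan extension of its restriction to
representables. Since `a_J` is a localization and `K`-sheaves are full in presheaves,
transformations `f^* ⟶ g^*` are those of `H_f` to `H_g` (`toDistributor_map_bijective`). That `H_f`
is a distributor of sites rests on one fact: a section of `Φ(P)`, for `Φ` cocontinuous, comes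
locally from some `Φ(y_c)` (`sieveOfSection_representableSections_mem`). Applied to the terminal
presheaf, binary products, equalizers and covering sieves, it yields flatness and cover-distribution
(`representableDistributor_isContinuous`).

Essential surjectivity, between small sites: flatness gives a local calculus of fractions for
equality in `P ⊗ A` (`IsCoverFlat.tensorSieve_mem`), which makes `P ↦ a_K (P ⊗ A)` left exact
(`IsCoverFlat.preservesFiniteLimits_tensor`). Cover-distribution makes its right adjoint take values
in `J`-sheaves (`isSheaf_restrictedULiftYoneda`). Large sites are replaced by small dense
subcategories; the values on all of `C` are recovered by
`IsDistributorOfSites.W_tensorRepresentableHom`. -/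

/-- A cocontinuous functor on presheaves is the left Kan extension along the Yoneda embedding of
its restriction to representables. -/
lemma isLeftKanExtension_yoneda_of_isIso {L : (Cᵒᵖ ⥤ Type v) ⥤ E} [L.IsLeftAdjoint]
    {A : C ⥤ E} (α : A ⟶ yoneda ⋙ L) [IsIso α] : L.IsLeftKanExtension α := by
  apply Functor.LeftExtension.IsPointwiseLeftKanExtension.isLeftKanExtension
    (E := Functor.LeftExtension.mk _ α)
  intro P
  -- The tautological colimit is indexed by the elements of `P`, whose objects live in `max u₁ v`;
  -- preservation of small colimits would not suffice.
  have : PreservesColimitsOfSize.{v, max u₁ v} L :=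
    (Adjunction.ofIsLeftAdjoint L).leftAdjoint_preservesColimits
  let e : CostructuredArrow.proj yoneda P ⋙ A ≅
      (CostructuredArrow.proj yoneda P ⋙ yoneda) ⋙ L :=
    Functor.isoWhiskerLeft _ (asIso α)
  refine (IsColimit.precomposeHomEquiv e.symm _).1 ?_
  exact IsColimit.ofIsoColimit
    (isColimitOfPreserves L (Presheaf.isColimitTautologicalCocone P))
    (Cocone.ext (Iso.refl _) (fun j => by
      simp only [e, Functor.LeftExtension.coconeAt]
      simp
      exact congrArg (α.app j.left ≫ ·) (Category.comp_id (L.map j.hom))))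

end Cocontinuous

section Elements

variable {C : Type u₁} [Category.{v} C] {D : Type u₂} [Category.{v} D]
  {K : GrothendieckTopology D} (Φ : (Cᵒᵖ ⥤ Type v) ⥤ Sheaf K (Type v))

/-- The distributor `(d, c) ↦ Φ(y_c)(d)` of a functor `Φ` from presheaves to sheaves. -/
abbrev representableDistributor : Profunctor.{v} C D :=
  yoneda ⋙ Φ ⋙ sheafToPresheaf K (Type v)

/-- The sections of `Φ(P)` coming from some `Φ(y_c)` along some `y_c ⟶ P`. -/
def representableSections (P : Cᵒᵖ ⥤ Type v) : Subfunctor (Φ.obj P).obj where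
  obj d := {z | ∃ (c : C) (p : yoneda.obj c ⟶ P) (x : (Φ.obj (yoneda.obj c)).obj.obj d),
    (Φ.map p).hom.app d x = z}
  map := by
    rintro d d' v _ ⟨c, p, x, rfl⟩
    exact ⟨c, p, (Φ.obj (yoneda.obj c)).obj.map v x, NatTrans.naturality_apply _ _ _⟩

/-- If `Φ` is cocontinuous, the sections of `Φ(P)` come locally from representables. -/
lemma sieveOfSection_representableSections_mem [Φ.IsLeftAdjoint] (P : Cᵒᵖ ⥤ Type v) {d : D}
    (z : (Φ.obj P).obj.obj (op d)) : (representableSections Φ P).sieveOfSection z ∈ K d := by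
  have hΦ : PreservesColimitsOfSize.{v, max u₁ v} Φ :=
    (Adjunction.ofIsLeftAdjoint Φ).leftAdjoint_preservesColimits
  let hc := isColimitOfPreserves Φ (Presheaf.isColimitTautologicalCocone P)
  -- Every coprojection of the colimit `Φ(P)` factors through this subsheaf, so its inclusion has a
  -- section and every `z` belongs to it.
  let G := (representableSections Φ P).sheafify K
  let X : Sheaf K (Type v) := ⟨G.toFunctor, (isSheaf_iff_isSheaf_of_type _ _).2
    (Subfunctor.sheafify_isSheaf _ ((isSheaf_iff_isSheaf_of_type _ _).1 (Φ.obj P).property))⟩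
  let i : X ⟶ Φ.obj P := ⟨G.ι⟩
  let s : Cocone ((CostructuredArrow.proj yoneda P ⋙ yoneda) ⋙ Φ) :=
    { pt := X
      ι :=
        { app j := ⟨G.lift (Φ.map j.hom).hom (by
            rintro e _ ⟨x, rfl⟩
            exact Subfunctor.le_sheafify _ _ _ ⟨_, j.hom, x, rfl⟩)⟩
          naturality j j' f := by
            ext e x
            have := CostructuredArrow.w f
            apply Subtype.ext
            change (Φ.map j'.hom).hom.app e ((Φ.map (yoneda.map f.left)).hom.app e x) =
              (Φ.map j.hom).hom.app e x
            rw [← this, Φ.map_comp]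
            rfl } }
  have h : hc.desc s ≫ i = 𝟙 _ := by
    apply hc.hom_ext
    intro j
    rw [← Category.assoc, hc.fac]
    rfl
  have hz := congr_arg (fun φ : Φ.obj P ⟶ Φ.obj P => φ.hom.app (op d) z) h
  have hz' : (((hc.desc s).hom.app (op d) z : G.obj (op d)) : (Φ.obj P).obj.obj (op d)) = z := hz
  rw [← hz']
  exact ((hc.desc s).hom.app (op d) z : G.obj (op d)).2

lemma exists_of_representable [Φ.IsLeftAdjoint] (P : Cᵒᵖ ⥤ Type v) {d : D}
    (z : (Φ.obj P).obj.obj (op d)) :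
    ∃ S ∈ K d, ∀ ⦃d' : D⦄ (v : d' ⟶ d), S v →
      ∃ (c : C) (p : yoneda.obj c ⟶ P) (x : (Φ.obj (yoneda.obj c)).obj.obj (op d')),
        (Φ.map p).hom.app (op d') x = (Φ.obj P).obj.map v.op z :=
  ⟨_, sieveOfSection_representableSections_mem Φ P z, fun _ _ h => h⟩

/-- The sections over `d` of the values of `Φ`. -/
abbrev sectionsFunctor (d : D) : (Cᵒᵖ ⥤ Type v) ⥤ Type v :=
  Φ ⋙ sheafToPresheaf K (Type v) ⋙ (evaluation _ _).obj (op d)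

lemma sectionsFunctor_preservesFiniteLimits [PreservesFiniteLimits Φ] (d : D) :
    PreservesFiniteLimits (sectionsFunctor Φ d) := by
  have : PreservesFiniteLimits (sheafToPresheaf K (Type v)) := inferInstance
  have : PreservesFiniteLimits ((evaluation Dᵒᵖ (Type v)).obj (op d)) := inferInstance
  have := comp_preservesFiniteLimits (sheafToPresheaf K (Type v))
    ((evaluation Dᵒᵖ (Type v)).obj (op d))
  exact comp_preservesFiniteLimits _ _

section

variable [Φ.IsLeftAdjoint] [PreservesFiniteLimits Φ]

lemma representableDistributor_nonempty_mem (d : D) :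
    (representableDistributor Φ).nonemptySieve d ∈ K d := by
  have := sectionsFunctor_preservesFiniteLimits Φ d
  let t := isLimitOfPreserves (sectionsFunctor Φ d) (terminalIsTerminal (C := Cᵒᵖ ⥤ Type v))
  let z : (Φ.obj (⊤_ (Cᵒᵖ ⥤ Type v))).obj.obj (op d) :=
    (Types.isLimitEquivSections t).symm ⟨fun j => j.as.elim, fun {j} => j.as.elim⟩
  obtain ⟨S, hS, h⟩ := exists_of_representable Φ _ z
  refine K.superset_covering ?_ hS
  intro d' v hv
  obtain ⟨c, p, x, -⟩ := h v hv
  exact ⟨c, ⟨x⟩⟩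

/-- By left exactness the pair `(x, x')` is a section of `Φ(y_c × y_c')`. Locally it comes from some
`y_c'' ⟶ y_c × y_c'`, which by Yoneda is the required span. The terminal and equalizer conditions
follow the same pattern. -/
lemma representableDistributor_span_mem {c c' : C} {d : D}
    (x : ((representableDistributor Φ).obj c).obj (op d))
    (x' : ((representableDistributor Φ).obj c').obj (op d)) :
    (representableDistributor Φ).spanSieve x x' ∈ K d := by
  have := sectionsFunctor_preservesFiniteLimits Φ d
  let t := mapIsLimitOfPreservesOfIsLimit (sectionsFunctor Φ d) _ _
    (prodIsProd (yoneda.obj c) (yoneda.obj c'))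
  let z : (Φ.obj (yoneda.obj c ⨯ yoneda.obj c')).obj.obj (op d) :=
    BinaryFan.IsLimit.lift' t (↾fun _ : PUnit => x) (↾fun _ => x') |>.1 PUnit.unit
  have hz : (Φ.map prod.fst).hom.app (op d) z = x :=
    congr_arg (fun φ : PUnit.{v+1} ⟶ _ => φ PUnit.unit)
      (BinaryFan.IsLimit.lift' t (↾fun _ : PUnit => x) (↾fun _ => x')).2.1
  have hz' : (Φ.map prod.snd).hom.app (op d) z = x' :=
    congr_arg (fun φ : PUnit.{v+1} ⟶ _ => φ PUnit.unit)
      (BinaryFan.IsLimit.lift' t (↾fun _ : PUnit => x) (↾fun _ => x')).2.2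
  obtain ⟨S, hS, h⟩ := exists_of_representable Φ _ z
  refine K.superset_covering ?_ hS
  intro d' v hv
  obtain ⟨c'', p, y, hy⟩ := h v hv
  refine ⟨c'', yoneda.preimage (p ≫ prod.fst), yoneda.preimage (p ≫ prod.snd), y, ?_, ?_⟩
  · change (Φ.map (yoneda.map _)).hom.app _ _ = _
    rw [yoneda.map_preimage, ← hz, Φ.map_comp]
    change (Φ.map prod.fst).hom.app (op d') ((Φ.map p).hom.app (op d') y) = _
    rw [hy]
    exact NatTrans.naturality_apply _ _ _
  · change (Φ.map (yoneda.map _)).hom.app _ _ = _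
    rw [yoneda.map_preimage, ← hz', Φ.map_comp]
    change (Φ.map prod.snd).hom.app (op d') ((Φ.map p).hom.app (op d') y) = _
    rw [hy]
    exact NatTrans.naturality_apply _ _ _

lemma representableDistributor_equalizer_mem {c c' : C} (u u' : c' ⟶ c) {d : D}
    (x : ((representableDistributor Φ).obj c').obj (op d))
    (hx : ((representableDistributor Φ).map u).app (op d) x =
      ((representableDistributor Φ).map u').app (op d) x) :
    (representableDistributor Φ).equalizerSieve u u' x ∈ K d := by
  have := sectionsFunctor_preservesFiniteLimits Φ d
  let t := isLimitForkMapOfIsLimit (sectionsFunctor Φ d) _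
    (equalizerIsEqualizer (yoneda.map u) (yoneda.map u'))
  have hx' : (↾fun _ : PUnit.{v+1} => x) ≫ (sectionsFunctor Φ d).map (yoneda.map u) =
      (↾fun _ : PUnit => x) ≫ (sectionsFunctor Φ d).map (yoneda.map u') := by
    ext
    exact hx
  let z : (Φ.obj (equalizer (yoneda.map u) (yoneda.map u'))).obj.obj (op d) :=
    (Fork.IsLimit.lift' t _ hx').1 PUnit.unit
  have hz : (Φ.map (equalizer.ι _ _)).hom.app (op d) z = x :=
    congr_arg (fun φ : PUnit.{v+1} ⟶ _ => φ PUnit.unit) (Fork.IsLimit.lift' t _ hx').2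
  obtain ⟨S, hS, h⟩ := exists_of_representable Φ _ z
  refine K.superset_covering ?_ hS
  intro d' v hv
  obtain ⟨c'', p, y, hy⟩ := h v hv
  refine ⟨c'', yoneda.preimage (p ≫ equalizer.ι _ _), y, ?_, ?_⟩
  · apply yoneda.map_injective
    rw [yoneda.map_comp, yoneda.map_comp, yoneda.map_preimage, Category.assoc, Category.assoc,
      equalizer.condition]
  · change (Φ.map (yoneda.map _)).hom.app _ _ = _
    rw [yoneda.map_preimage, ← hz, Φ.map_comp]
    change (Φ.map (equalizer.ι _ _)).hom.app (op d') ((Φ.map p).hom.app (op d') y) = _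
    rw [hy]
    exact NatTrans.naturality_apply _ _ _

end

/-- Because `Φ` inverts the inclusion of `S`, the element `x` lifts to `Φ(S)`, where it comes
locally from a map `y_c' ⟶ S`, that is, from an arrow of `S`. -/
lemma representableDistributor_coverDistributing [Φ.IsLeftAdjoint] (J : GrothendieckTopology C)
    (hΦ : ∀ ⦃c : C⦄ (S : Sieve c), S ∈ J c → IsIso (Φ.map S.functorInclusion)) :
    (representableDistributor Φ).IsCoverDistributing J K := by
  intro c d x S hS
  have := hΦ S hS
  let z : (Φ.obj S.functor).obj.obj (op d) := (inv (Φ.map S.functorInclusion)).hom.app (op d) x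
  have hz : (Φ.map S.functorInclusion).hom.app (op d) z = x :=
    congr_arg (fun φ : Φ.obj (yoneda.obj c) ⟶ _ => φ.hom.app (op d) x)
      (IsIso.inv_hom_id (Φ.map S.functorInclusion))
  obtain ⟨T, hT, h⟩ := exists_of_representable Φ _ z
  refine K.superset_covering ?_ hT
  intro d' v hv
  obtain ⟨c', p, y, hy⟩ := h v hv
  refine ⟨c', (p.app (op c') (𝟙 c')).1, y, (p.app (op c') (𝟙 c')).2, ?_⟩
  have hp : yoneda.map (p.app (op c') (𝟙 c')).1 = p ≫ S.functorInclusion := by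
    apply yonedaEquiv.injective
    simp [yonedaEquiv]
  change _ = (Φ.map (yoneda.map _)).hom.app _ _
  rw [hp, ← hz, Φ.map_comp]
  change _ = (Φ.map S.functorInclusion).hom.app (op d') ((Φ.map p).hom.app (op d') y)
  rw [hy]
  exact (NatTrans.naturality_apply _ _ _).symm

lemma representableDistributor_isContinuous [Φ.IsLeftAdjoint] [PreservesFiniteLimits Φ]
    (J : GrothendieckTopology C)
    (hΦ : ∀ ⦃c : C⦄ (S : Sieve c), S ∈ J c → IsIso (Φ.map S.functorInclusion)) :
    (representableDistributor Φ).IsContinuousDistributorOfSites J K where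
  coverDistributing := representableDistributor_coverDistributing Φ J hΦ
  coverFlat :=
    { nonempty_mem := representableDistributor_nonempty_mem Φ
      span_mem _ _ _ := representableDistributor_span_mem Φ
      equalizer_mem _ _ u u' _ := representableDistributor_equalizer_mem Φ u u' }
  isSheaf c := (Φ.obj (yoneda.obj c)).property

end Elements

end CategoryTheory

/-! ### Full faithfulness of `f ↦ H_f` -/

namespace CategoryTheory

section

variable {C : Type u₁} [Category.{v} C] {J : GrothendieckTopology C}

lemma GrothendieckTopology.W_functorInclusion {c : C} {S : Sieve c} (hS : S ∈ J c) :
    J.W (A := Type v) S.functorInclusion := by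
  intro Z hZ
  rw [isSheaf_iff_isSheaf_of_type] at hZ
  have h := (Presieve.isSheafFor_iff_yonedaSheafCondition (P := Z) (S := S)).1 (hZ S hS)
  rw [Function.bijective_iff_existsUnique]
  exact h

end

section

variable {C : Type u₁} [Category.{v} C] {D : Type u₂} [Category.{v} D]
  {J : GrothendieckTopology C} {K : GrothendieckTopology D}
  [J.IsSmallGenerated]

namespace GeometricMorphism

variable (f : GeometricMorphism (Sheaf K (Type v)) (Sheaf J (Type v)))

instance : f.inverseImage.IsLeftAdjoint := ⟨_, ⟨f.adj⟩⟩

instance : PreservesFiniteLimits f.inverseImage := f.preservesFiniteLimits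

/-- The inverse image of the sheaf associated with a presheaf. -/
noncomputable abbrev presheafInverseImage : (Cᵒᵖ ⥤ Type v) ⥤ Sheaf K (Type v) :=
  presheafToSheaf J (Type v) ⋙ f.inverseImage

instance : f.presheafInverseImage.IsLeftAdjoint :=
  ⟨_, ⟨(sheafificationAdjunction J (Type v)).comp f.adj⟩⟩

instance : PreservesFiniteLimits f.presheafInverseImage :=
  comp_preservesFiniteLimits _ _

lemma toDistributor_isContinuous :
    ((toDistributor J K).obj f).IsContinuousDistributorOfSites J K :=
  representableDistributor_isContinuous f.presheafInverseImage J (fun c S hS => by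
    have : IsIso ((presheafToSheaf J (Type v)).map S.functorInclusion) :=
      (J.W_iff _).1 (J.W_functorInclusion hS)
    exact inferInstanceAs (IsIso (f.inverseImage.map _)))

variable (J K) in
/-- The continuous distributor of sites `H_f` associated with a geometric morphism `f`. -/
noncomputable def toContinuousDistributor :
    GeometricMorphism (Sheaf K (Type v)) (Sheaf J (Type v)) ⥤ ContinuousDistributor J K :=
  ObjectProperty.lift _ (toDistributor J K) toDistributor_isContinuous

/-- A transformation `f^* ⟶ g^*` is the same as a transformation `H_f ⟶ H_g`. -/
lemma toDistributor_map_bijective (f g : GeometricMorphism (Sheaf K (Type v)) (Sheaf J (Type v))) :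
    Function.Bijective ((toDistributor J K).map : (f ⟶ g) → _) := by
  -- Three bijections compose: `a_J` is a localization at `J.W`, `f^* a_J` is a Kan extension along
  -- Yoneda, and sheaves are full in presheaves.
  have := isLeftKanExtension_yoneda_of_isIso (𝟙 (yoneda ⋙ f.presheafInverseImage))
  have h₁ := (Localization.fullyFaithfulWhiskeringLeft (presheafToSheaf J (Type v)) J.W
    (Sheaf K (Type v))).map_bijective f.inverseImage g.inverseImage
  have h₂ := (f.presheafInverseImage.homEquivOfIsLeftKanExtension
    (𝟙 (yoneda ⋙ f.presheafInverseImage)) g.presheafInverseImage).bijective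
  have h₃ := ((fullyFaithfulSheafToPresheaf K (Type v)).whiskeringRight C).map_bijective
    (yoneda ⋙ f.presheafInverseImage) (yoneda ⋙ g.presheafInverseImage)
  exact (h₃.comp h₂).comp h₁

instance : (toDistributor J K).Full := ⟨fun {f g} => (toDistributor_map_bijective f g).2⟩

instance : (toDistributor J K).Faithful :=
  ⟨fun {f g} _ _ h => (toDistributor_map_bijective f g).1 h⟩

instance : (toContinuousDistributor J K).Full :=
  inferInstanceAs (ObjectProperty.lift _ _ _).Full

instance : (toContinuousDistributor J K).Faithful :=
  inferInstanceAs (ObjectProperty.lift _ _ _).Faithful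

end GeometricMorphism

namespace Profunctor

variable [K.IsSmallGenerated]

/-- Such an `H` is sheaf-valued, so the sheafification counit gives `a_K H ≅ f^* a_J y`, and
cocontinuity makes this isomorphism a Kan extension. -/
lemma induces_of_iso {H : Profunctor.{v} C D}
    {f : GeometricMorphism (Sheaf K (Type v)) (Sheaf J (Type v))}
    (e : H ≅ (GeometricMorphism.toDistributor J K).obj f) : H.Induces f := by
  let i : H ⋙ presheafToSheaf K (Type v) ≅ yoneda ⋙ f.presheafInverseImage :=
    Functor.isoWhiskerRight e _ ≪≫
      Functor.isoWhiskerLeft (yoneda ⋙ f.presheafInverseImage)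
        (asIso (sheafificationAdjunction K (Type v)).counit) ≪≫ Functor.rightUnitor _
  exact ⟨i.hom, isLeftKanExtension_yoneda_of_isIso i.hom⟩

/-- Geometric morphisms induced by the same distributor have isomorphic distributors. -/
lemma Induces.nonempty_iso {H : Profunctor.{v} C D}
    {f g : GeometricMorphism (Sheaf K (Type v)) (Sheaf J (Type v))}
    (hf : H.Induces f) (hg : H.Induces g) :
    Nonempty ((GeometricMorphism.toDistributor J K).obj f ≅
      (GeometricMorphism.toDistributor J K).obj g) := by
  obtain ⟨α, _⟩ := hf
  obtain ⟨β, _⟩ := hg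
  let i : f.presheafInverseImage ≅ g.presheafInverseImage :=
    Functor.leftKanExtensionUnique _ α _ β
  exact ⟨Functor.isoWhiskerRight (Functor.isoWhiskerLeft yoneda i) (sheafToPresheaf K _)⟩

end Profunctor

end

end CategoryTheory

/-! ## Tensor product of a presheaf with a flat distributor -/

namespace CategoryTheory

namespace Profunctor

section

variable {C : Type u₁} [Category.{v} C] {D : Type u₂} [Category.{v} D] (A : Profunctor.{v} C D)

/-- Given `p ∈ P(c)`, `x ∈ A(d, c)` and `p' ∈ P(c')`, `x' ∈ A(d, c')`, the arrows `v : d' ⟶ d` along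
which `x` and `x'` both factor through a common `x'' ∈ A(d', c'')` by arrows `u : c'' ⟶ c` and
`u' : c'' ⟶ c'` such that `p u = p' u'`. -/
def tensorSieve {P : Cᵒᵖ ⥤ Type v} {c c' : C} {d : D} (p : P.obj (op c))
    (x : (A.obj c).obj (op d)) (p' : P.obj (op c')) (x' : (A.obj c').obj (op d)) : Sieve d where
  arrows d' v := ∃ (c'' : C) (u : c'' ⟶ c) (u' : c'' ⟶ c') (x'' : (A.obj c'').obj (op d')),
    P.map u.op p = P.map u'.op p' ∧ (A.map u).app (op d') x'' = (A.obj c).map v.op x ∧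
    (A.map u').app (op d') x'' = (A.obj c').map v.op x'
  downward_closed := by
    rintro d' d'' v ⟨c'', u, u', x'', hp, h, h'⟩ w
    refine ⟨c'', u, u', (A.obj c'').map w.op x'', hp, ?_, ?_⟩
    · rw [op_comp, Functor.map_comp_apply, ← h, NatTrans.naturality_apply]
    · rw [op_comp, Functor.map_comp_apply, ← h', NatTrans.naturality_apply]

variable {A} {P : Cᵒᵖ ⥤ Type v} {K : GrothendieckTopology D}

lemma tensorSieve_symm {c c' : C} {d : D} {p : P.obj (op c)}
    {x : (A.obj c).obj (op d)} {p' : P.obj (op c')} {x' : (A.obj c').obj (op d)}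
    (h : A.tensorSieve p x p' x' ∈ K d) : A.tensorSieve p' x' p x ∈ K d := by
  refine K.superset_covering ?_ h
  rintro d' v ⟨c'', u, u', x'', hp, h, h'⟩
  exact ⟨c'', u', u, x'', hp.symm, h', h⟩

lemma tensorSieve_map_mem {c c' : C} {d : D} (u : c' ⟶ c) (p : P.obj (op c))
    (x : (A.obj c').obj (op d)) :
    A.tensorSieve (P.map u.op p) x p ((A.map u).app (op d) x) ∈ K d := by
  refine K.superset_covering ?_ (K.top_mem d)
  intro d' v _
  exact ⟨c', 𝟙 _, u, (A.obj c').map v.op x, by simp, by simp, NatTrans.naturality_apply _ _ _⟩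

/-- Both hypotheses factor `x₂` locally, through `y` and through `z`. Flatness dominates `y` and `z`
by one element, then equalizes the two resulting arrows into `c₂`. -/
lemma IsCoverFlat.tensorSieve_trans (hA : A.IsCoverFlat K) {c₁ c₂ c₃ : C} {d : D}
    {p₁ : P.obj (op c₁)} {x₁ : (A.obj c₁).obj (op d)} {p₂ : P.obj (op c₂)}
    {x₂ : (A.obj c₂).obj (op d)} {p₃ : P.obj (op c₃)} {x₃ : (A.obj c₃).obj (op d)}
    (h₁₂ : A.tensorSieve p₁ x₁ p₂ x₂ ∈ K d) (h₂₃ : A.tensorSieve p₂ x₂ p₃ x₃ ∈ K d) :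
    A.tensorSieve p₁ x₁ p₃ x₃ ∈ K d := by
  refine K.transitive (K.intersection_covering h₁₂ h₂₃) _ ?_
  rintro d' v ⟨⟨c₄, u₁, u₂, y, hp, h₁, h₂⟩, ⟨c₅, w₂, w₃, z, hp', h₂', h₃⟩⟩
  refine K.transitive (hA.span_mem y z) _ ?_
  rintro d'' v' ⟨e, s, t, a, hs, ht⟩
  have ha : (A.map (s ≫ u₂)).app (op d'') a = (A.map (t ≫ w₂)).app (op d'') a := by
    simp only [Functor.map_comp, NatTrans.comp_app, comp_apply, hs, ht, NatTrans.naturality_apply,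
      h₂, h₂']
  refine K.superset_covering ?_ (hA.equalizer_mem _ _ a ha)
  rintro d''' v'' ⟨e', q, b, hq, hb⟩
  refine ⟨e', q ≫ s ≫ u₁, q ≫ t ≫ w₃, b, ?_, ?_, ?_⟩
  · have hq' := congr_arg (fun f => P.map f.op p₂) hq
    simp only [op_comp, Functor.map_comp_apply] at hq' ⊢
    rw [hp, ← hp']
    exact hq'
  · simp only [Functor.map_comp, NatTrans.comp_app, comp_apply, hb, NatTrans.naturality_apply,
      hs, h₁, op_comp]
  · simp only [Functor.map_comp, NatTrans.comp_app, comp_apply, hb, NatTrans.naturality_apply,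
      ht, h₃, op_comp]

variable (A) in
/-- The arrows along which `x` factors through some `w` such that `p w = p' w`. -/
def commonRestrictionSieve {c : C} {d : D} (p p' : P.obj (op c)) (x : (A.obj c).obj (op d)) :
    Sieve d where
  arrows d' v := ∃ (c' : C) (w : c' ⟶ c) (y : (A.obj c').obj (op d')),
    P.map w.op p = P.map w.op p' ∧ (A.map w).app (op d') y = (A.obj c).map v.op x
  downward_closed := by
    rintro d' d'' v ⟨c', w, y, hp, h⟩ t
    refine ⟨c', w, (A.obj c').map t.op y, hp, ?_⟩
    rw [op_comp, Functor.map_comp_apply, ← h, NatTrans.naturality_apply]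

/-- If `(p, x)` and `(p', x)` are identified locally, then locally `p` and `p'` have the same
restriction along some `w` through which `x` factors. -/
lemma IsCoverFlat.commonRestrictionSieve_mem (hA : A.IsCoverFlat K) {c : C} {d : D}
    {p p' : P.obj (op c)} {x : (A.obj c).obj (op d)} (h : A.tensorSieve p x p' x ∈ K d) :
    A.commonRestrictionSieve p p' x ∈ K d := by
  refine K.transitive h _ ?_
  rintro d' v ⟨c', u, u', y, hp, h₁, h₂⟩
  refine K.superset_covering ?_ (hA.equalizer_mem u u' y (h₁.trans h₂.symm))
  rintro d'' w ⟨e, q, b, hq, hb⟩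
  refine ⟨e, q ≫ u, b, ?_, ?_⟩
  · conv_rhs => rw [hq]
    rw [op_comp, op_comp, Functor.map_comp_apply, Functor.map_comp_apply, hp]
  · simp only [Functor.map_comp, NatTrans.comp_app, comp_apply, hb, NatTrans.naturality_apply,
      h₁, op_comp]

end

section

variable {C : Type v} [SmallCategory C] {D : Type v} [SmallCategory D] (A : Profunctor.{v} C D)

/-- The functor `P ↦ P ⊗ A`, the left Kan extension of `A` along the Yoneda embedding. -/
noncomputable def tensor : (Cᵒᵖ ⥤ Type v) ⥤ Dᵒᵖ ⥤ Type v :=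
  uliftYoneda.{v}.leftKanExtension A

/-- The comparison isomorphism `A(-, c) ≅ y_c ⊗ A`. -/
noncomputable def tensorUnit : A ⟶ uliftYoneda.{v} ⋙ A.tensor :=
  uliftYoneda.{v}.leftKanExtensionUnit A

instance : A.tensor.IsLeftKanExtension A.tensorUnit :=
  inferInstanceAs (Functor.IsLeftKanExtension _ (uliftYoneda.{v}.leftKanExtensionUnit A))

/-- The right adjoint `E ↦ (c ↦ Hom(A(-, c), E))` of `P ↦ P ⊗ A`. -/
noncomputable def tensorAdj : A.tensor ⊣ Presheaf.restrictedULiftYoneda.{v} A :=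
  Presheaf.uliftYonedaAdjunction.{v} A.tensor A.tensorUnit

instance : A.tensor.IsLeftAdjoint := ⟨_, ⟨A.tensorAdj⟩⟩

variable {A} {P Q : Cᵒᵖ ⥤ Type v} {c : C} {d : D}

/-- The element `p ⊗ x` of `P ⊗ A`. -/
noncomputable def tmul (p : P.obj (op c)) (x : (A.obj c).obj (op d)) :
    (A.tensor.obj P).obj (op d) :=
  (A.tensor.map (uliftYonedaEquiv.symm p)).app (op d) ((A.tensorUnit.app c).app (op d) x)

lemma map_tmul (f : P ⟶ Q) (p : P.obj (op c)) (x : (A.obj c).obj (op d)) :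
    (A.tensor.map f).app (op d) (tmul p x) = tmul (f.app (op c) p) x := by
  have h : uliftYonedaEquiv.{v}.symm (f.app (op c) p) = uliftYonedaEquiv.symm p ≫ f := by
    apply uliftYonedaEquiv.injective
    simp [uliftYonedaEquiv_comp]
  rw [tmul, tmul, h, Functor.map_comp]
  rfl

lemma restrict_tmul {d' : D} (v : d' ⟶ d) (p : P.obj (op c)) (x : (A.obj c).obj (op d)) :
    (A.tensor.obj P).map v.op (tmul p x) = tmul p ((A.obj c).map v.op x) := by
  rw [tmul, tmul, NatTrans.naturality_apply]
  exact (NatTrans.naturality_apply (A.tensor.map (uliftYonedaEquiv.symm p)) v.op _).symm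

lemma tmul_map {c' : C} (u : c' ⟶ c) (p : P.obj (op c)) (x : (A.obj c').obj (op d)) :
    tmul (P.map u.op p) x = tmul p ((A.map u).app (op d) x) := by
  have h : uliftYonedaEquiv.{v}.symm (P.map u.op p) =
      uliftYoneda.{v}.map u ≫ uliftYonedaEquiv.symm p := by
    rw [uliftYonedaEquiv_symm_map]
    rfl
  have h' := congr_arg (fun φ => φ.app (op d) x) (A.tensorUnit.naturality u)
  dsimp at h'
  rw [tmul, tmul, h, Functor.map_comp, h']
  rfl

lemma tensorAdj_homEquiv_apply {E : Dᵒᵖ ⥤ Type v} (f : A.tensor.obj P ⟶ E) (p : P.obj (op c))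
    (x : (A.obj c).obj (op d)) :
    (ULift.down ((A.tensorAdj.homEquiv P E f).app (op c) p)).app (op d) x =
      f.app (op d) (tmul p x) := by
  have h := Presheaf.uliftYonedaAdjunction_homEquiv_app.{v, v, v, v, v + 1} A.tensor A.tensorUnit
    f p
  exact congr_arg (fun φ => (ULift.down φ).app (op d) x) h

/-- The colimit presentation of `(P ⊗ A)(d)`. -/
noncomputable def isColimitTensor (P : Cᵒᵖ ⥤ Type v) (d : D) :=
  isColimitOfPreserves ((evaluation Dᵒᵖ (Type v)).obj (op d))
    (Functor.isPointwiseLeftKanExtensionOfIsLeftKanExtension A.tensor A.tensorUnit P)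

lemma isColimitTensor_ι (j : CostructuredArrow uliftYoneda.{v} P)
    (x : (A.obj j.left).obj (op d)) :
    (((evaluation Dᵒᵖ (Type v)).obj (op d)).mapCocone
      ((Functor.LeftExtension.mk A.tensor A.tensorUnit).coconeAt P)).ι.app j x =
      tmul (uliftYonedaEquiv j.hom) x := by
  rw [tmul, Equiv.symm_apply_apply]
  rfl

lemma exists_tmul (z : (A.tensor.obj P).obj (op d)) :
    ∃ (c : C) (p : P.obj (op c)) (x : (A.obj c).obj (op d)), tmul p x = z := by
  obtain ⟨j, x, h⟩ := Types.jointly_surjective_of_isColimit (isColimitTensor (A := A) P d) z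
  exact ⟨j.left, uliftYonedaEquiv j.hom, x, (isColimitTensor_ι j x).symm.trans h⟩

/-- Equality in the colimit is the equivalence relation generated by `(p u, x) ∼ (p, A(u)(x))`.
Being identified locally by a common refinement is already an equivalence relation, by flatness, and
contains these generators. -/
lemma IsCoverFlat.tensorSieve_mem {K : GrothendieckTopology D} (hA : A.IsCoverFlat K) {c' : C}
    {p : P.obj (op c)} {x : (A.obj c).obj (op d)} {p' : P.obj (op c')}
    {x' : (A.obj c').obj (op d)} (h : tmul p x = tmul p' x') :
    A.tensorSieve p x p' x' ∈ K d := by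
  have hc := ((Types.isColimit_iff_coconeTypesIsColimit _).1
    ⟨isColimitTensor (A := A) P d⟩).bijective.1
  let j : CostructuredArrow uliftYoneda.{v} P := CostructuredArrow.mk (uliftYonedaEquiv.symm p)
  let j' : CostructuredArrow uliftYoneda.{v} P := CostructuredArrow.mk (uliftYonedaEquiv.symm p')
  let F := (CostructuredArrow.proj uliftYoneda.{v} P ⋙ A) ⋙ (evaluation Dᵒᵖ (Type v)).obj (op d)
  have h₁ := (Functor.ιColimitType_eq_iff F (j := j) (j' := j') x x').1 (hc h)
  have key : ∀ a b : Σ j, F.obj j, Relation.EqvGen F.ColimitTypeRel a b →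
      A.tensorSieve (uliftYonedaEquiv a.1.hom) a.2 (uliftYonedaEquiv b.1.hom) b.2 ∈ K d := by
    intro a b hab
    induction hab with
    | rel a b hab =>
      obtain ⟨f, hf⟩ := hab
      have hb : P.map f.left.op (uliftYonedaEquiv b.1.hom) = uliftYonedaEquiv a.1.hom := by
        rw [uliftYonedaEquiv_naturality]
        exact congr_arg _ (CostructuredArrow.w f)
      rw [hf, ← hb]
      exact tensorSieve_map_mem f.left (uliftYonedaEquiv b.1.hom) a.2
    | refl a =>
      have := tensorSieve_map_mem (A := A) (K := K) (𝟙 _) (uliftYonedaEquiv a.1.hom) a.2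
      simpa using! this
    | symm a b _ h => exact tensorSieve_symm h
    | trans a b c _ _ h h' => exact hA.tensorSieve_trans h h'
  have h₂ := key _ _ h₁
  simpa [j, j'] using! h₂

end

end Profunctor

end CategoryTheory

/-! ## Exactness of the tensor product with a flat distributor -/

namespace CategoryTheory

lemma FunctorToTypes.ext_of_isPullback {C : Type u₁} [Category.{v} C]
    {W X Y Z : Cᵒᵖ ⥤ Type v} {t : W ⟶ X} {l : W ⟶ Y} {r : X ⟶ Z} {b : Y ⟶ Z}
    (h : IsPullback t l r b) {c : Cᵒᵖ} {x y : W.obj c} (h₁ : t.app c x = t.app c y)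
    (h₂ : l.app c x = l.app c y) : x = y :=
  Types.ext_of_isPullback (h.map ((evaluation _ _).obj c)) h₁ h₂

lemma FunctorToTypes.exists_of_isPullback {C : Type u₁} [Category.{v} C]
    {W X Y Z : Cᵒᵖ ⥤ Type v} {t : W ⟶ X} {l : W ⟶ Y} {r : X ⟶ Z} {b : Y ⟶ Z}
    (h : IsPullback t l r b) {c : Cᵒᵖ} (x : X.obj c) (y : Y.obj c)
    (hxy : r.app c x = b.app c y) : ∃ w, t.app c w = x ∧ l.app c w = y := by
  obtain ⟨w, h₁, h₂⟩ := Types.exists_of_isPullback (h.map ((evaluation _ _).obj c)) x y hxy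
  exact ⟨w, h₁, h₂⟩

namespace Profunctor

variable {C : Type v} [SmallCategory C] {D : Type v} [SmallCategory D] {A : Profunctor.{v} C D}
  {J : GrothendieckTopology C} {K : GrothendieckTopology D} {P Q R : Cᵒᵖ ⥤ Type v}

lemma tensorSieve_restrict_eq {c c' : C} {d d' : D} {p : P.obj (op c)}
    {x : (A.obj c).obj (op d)} {p' : P.obj (op c')} {x' : (A.obj c').obj (op d)} {v : d' ⟶ d}
    (h : A.tensorSieve p x p' x' v) :
    (A.tensor.obj P).map v.op (tmul p x) = (A.tensor.obj P).map v.op (tmul p' x') := by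
  obtain ⟨c'', u, u', y, hp, h₁, h₂⟩ := h
  rw [restrict_tmul, restrict_tmul, ← h₁, ← h₂, ← tmul_map, ← tmul_map, hp]

/-- The arrows along which `s ∈ P ⊗ A` and `t ∈ Q ⊗ A` become elements `p ⊗ x` and `q ⊗ x` with the
same second component. -/
def commonTmulSieve {d : D} (s : (A.tensor.obj P).obj (op d)) (t : (A.tensor.obj Q).obj (op d)) :
    Sieve d where
  arrows d' v := ∃ (c : C) (p : P.obj (op c)) (q : Q.obj (op c)) (x : (A.obj c).obj (op d')),
    (A.tensor.obj P).map v.op s = tmul p x ∧ (A.tensor.obj Q).map v.op t = tmul q x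
  downward_closed := by
    rintro d' d'' v ⟨c, p, q, x, h, h'⟩ w
    refine ⟨c, p, q, (A.obj c).map w.op x, ?_, ?_⟩
    · rw [op_comp, Functor.map_comp_apply, h, restrict_tmul]
    · rw [op_comp, Functor.map_comp_apply, h', restrict_tmul]

lemma IsCoverFlat.commonTmulSieve_mem (hA : A.IsCoverFlat K) {d : D}
    (s : (A.tensor.obj P).obj (op d)) (t : (A.tensor.obj Q).obj (op d)) :
    commonTmulSieve s t ∈ K d := by
  obtain ⟨c, p, x, rfl⟩ := exists_tmul s
  obtain ⟨c', q, x', rfl⟩ := exists_tmul t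
  refine K.superset_covering ?_ (hA.span_mem x x')
  rintro d' v ⟨c'', u, u', y, h, h'⟩
  refine ⟨c'', P.map u.op p, Q.map u'.op q, y, ?_, ?_⟩
  · rw [restrict_tmul, tmul_map, h]
  · rw [restrict_tmul, tmul_map, h']

lemma IsCoverFlat.commonRestrictionSieve_mem_of_tmul_eq (hA : A.IsCoverFlat K) {c : C} {d : D}
    {p p' : P.obj (op c)} {x : (A.obj c).obj (op d)} (h : tmul p x = tmul p' x) :
    A.commonRestrictionSieve p p' x ∈ K d :=
  hA.commonRestrictionSieve_mem (hA.tensorSieve_mem h)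

lemma IsCoverFlat.isLocallyInjective_tensor_map (hA : A.IsCoverFlat K) (f : P ⟶ Q)
    (hf : ∀ c, Function.Injective (f.app c)) :
    Presheaf.IsLocallyInjective K (A.tensor.map f) where
  equalizerSieve_mem {d} s t h := by
    obtain ⟨c, p, x, rfl⟩ := exists_tmul s
    obtain ⟨c', p', x', rfl⟩ := exists_tmul t
    rw [map_tmul, map_tmul] at h
    refine K.superset_covering ?_ (hA.tensorSieve_mem h)
    rintro d' v ⟨c'', u, u', y, hp, h₁, h₂⟩
    refine tensorSieve_restrict_eq ⟨c'', u, u', y, hf _ ?_, h₁, h₂⟩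
    rw [NatTrans.naturality_apply, NatTrans.naturality_apply, hp]

/-- Flatness gives local injectivity. For local surjectivity, `u ⊗ x = 𝟙 ⊗ A(u)(x)`, and
cover-distribution factors `A(u)(x)` locally through arrows of `S`. -/
lemma W_tensor_map_functorInclusion (hA : A.IsCoverFlat K) (hA' : A.IsCoverDistributing J K)
    {c : C} {S : Sieve c} (hS : S ∈ J c) : K.W (A.tensor.map S.functorInclusion) := by
  have := hA.isLocallyInjective_tensor_map S.functorInclusion (fun c' _ _ h => Subtype.ext h)
  have : Presheaf.IsLocallySurjective K (A.tensor.map S.functorInclusion) :=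
    { imageSieve_mem {d} s := by
        obtain ⟨c', u, x, rfl⟩ := exists_tmul s
        have hu (c₀ : C) (w : c₀ ⟶ c) {d₀ : D} (x₀ : (A.obj c₀).obj (op d₀)) :
            tmul (P := yoneda.obj c) w x₀ = tmul (P := yoneda.obj c) (𝟙 c) ((A.map w).app _ x₀) := by
          rw [← tmul_map]
          congr 1
          exact (Category.comp_id w).symm
        refine K.superset_covering ?_ (hA' ((A.map u).app _ x) S hS)
        rintro d' v ⟨c'', u', y, hu', h⟩
        refine ⟨tmul (P := S.functor) (⟨u', hu'⟩ : {g // S.arrows g}) y, ?_⟩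
        refine (map_tmul _ _ _).trans ?_
        refine (hu c'' u' y).trans ?_
        rw [← h, ← restrict_tmul, ← hu] }
  exact K.W_of_isLocallyBijective _

/-- If `A` is a distributor of sites and `E` is a sheaf, then `c ↦ Hom(A(-, c), E)` is a sheaf. -/
lemma isSheaf_restrictedULiftYoneda (hA : A.IsCoverFlat K) (hA' : A.IsCoverDistributing J K)
    {E : Dᵒᵖ ⥤ Type v} (hE : Presheaf.IsSheaf K E) :
    Presheaf.IsSheaf J ((Presheaf.restrictedULiftYoneda.{v} A).obj E) := by
  rw [isSheaf_iff_isSheaf_of_type]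
  intro c S hS
  rw [Presieve.isSheafFor_iff_yonedaSheafCondition]
  -- By adjunction, the sheaf condition at `S` says that maps into `E` extend uniquely along `S ⊗ A
  -- ⟶ y_c ⊗ A`.
  have h := W_tensor_map_functorInclusion hA hA' hS E hE
  rw [A.tensorAdj.map_comp_bijective_iff, Function.bijective_iff_existsUnique] at h
  exact h

lemma IsCoverFlat.W_tensor_terminal (hA : A.IsCoverFlat K) :
    K.W (terminal.from (A.tensor.obj (⊤_ (Cᵒᵖ ⥤ Type v)))) := by
  have hP (c : Cᵒᵖ) : Nonempty (Unique ((⊤_ (Cᵒᵖ ⥤ Type v)).obj c)) :=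
    ⟨Types.isTerminalEquivUnique _ (IsTerminal.isTerminalObj ((evaluation _ _).obj c) _
      terminalIsTerminal)⟩
  have hQ (d : Dᵒᵖ) : Nonempty (Unique ((⊤_ (Dᵒᵖ ⥤ Type v)).obj d)) :=
    ⟨Types.isTerminalEquivUnique _ (IsTerminal.isTerminalObj ((evaluation _ _).obj d) _
      terminalIsTerminal)⟩
  have : Presheaf.IsLocallyInjective K (terminal.from (A.tensor.obj (⊤_ (Cᵒᵖ ⥤ Type v)))) :=
    { equalizerSieve_mem {d} s t _ := by
        refine K.superset_covering ?_ (hA.commonTmulSieve_mem s t)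
        rintro d' v ⟨c, p, q, x, h, h'⟩
        have := (hP (op c)).some
        exact h.trans ((congr_arg (fun r => tmul r x) (Subsingleton.elim p q)).trans h'.symm) }
  have : Presheaf.IsLocallySurjective K (terminal.from (A.tensor.obj (⊤_ (Cᵒᵖ ⥤ Type v)))) :=
    { imageSieve_mem {d} s := by
        refine K.superset_covering ?_ (hA.nonempty_mem d)
        rintro d' v ⟨c, ⟨x⟩⟩
        have := (hQ (op d')).some
        exact ⟨tmul (hP (op c)).some.default x, Subsingleton.elim (α := (⊤_ (Dᵒᵖ ⥤ Type v)).obj _)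
          _ _⟩ }
  exact K.W_of_isLocallyBijective _

/-- Locally the two sections are `p ⊗ x` and `q ⊗ x` with the same `x`. Refining `x` twice makes
first the `P`-components and then the `Q`-components of `p` and `q` agree, so the restrictions of
`p` and `q` coincide in the pullback. -/
lemma IsCoverFlat.isLocallyInjective_pullbackComparison (hA : A.IsCoverFlat K)
    (f : P ⟶ R) (g : Q ⟶ R) :
    Presheaf.IsLocallyInjective K (pullbackComparison A.tensor f g) where
  equalizerSieve_mem {d} s t h := by
    have h₁ : (A.tensor.map (pullback.fst f g)).app d s =
        (A.tensor.map (pullback.fst f g)).app d t := by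
      rw [← pullbackComparison_comp_fst, NatTrans.comp_app, comp_apply, h, comp_apply]
    have h₂ : (A.tensor.map (pullback.snd f g)).app d s =
        (A.tensor.map (pullback.snd f g)).app d t := by
      rw [← pullbackComparison_comp_snd, NatTrans.comp_app, comp_apply, h, comp_apply]
    refine K.transitive (hA.commonTmulSieve_mem s t) _ ?_
    rintro d₁ v₁ ⟨c, p, q, x, hs, ht⟩
    have hx : tmul ((pullback.fst f g).app _ p) x = tmul ((pullback.fst f g).app _ q) x := by
      rw [← map_tmul, ← map_tmul, ← hs, ← ht, NatTrans.naturality_apply,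
        NatTrans.naturality_apply, h₁]
    have hx' : tmul ((pullback.snd f g).app _ p) x = tmul ((pullback.snd f g).app _ q) x := by
      rw [← map_tmul, ← map_tmul, ← hs, ← ht, NatTrans.naturality_apply,
        NatTrans.naturality_apply, h₂]
    refine K.transitive (hA.commonRestrictionSieve_mem_of_tmul_eq hx) _ ?_
    rintro d₂ v₂ ⟨c₂, w, y, hw, hy⟩
    have hy' : tmul ((pullback.snd f g).app _ (((pullback f g)).map w.op p)) y =
        tmul ((pullback.snd f g).app _ (((pullback f g)).map w.op q)) y := by
      rw [NatTrans.naturality_apply, NatTrans.naturality_apply, tmul_map, tmul_map, hy,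
        ← restrict_tmul, ← restrict_tmul, hx']
    refine K.superset_covering ?_ (hA.commonRestrictionSieve_mem_of_tmul_eq hy')
    rintro d₃ v₃ ⟨c₃, w', z, hw', hz⟩
    have hpq : (pullback f g).map w'.op ((pullback f g).map w.op p) =
        (pullback f g).map w'.op ((pullback f g).map w.op q) := by
      apply FunctorToTypes.ext_of_isPullback (.of_hasPullback f g)
      · simp only [NatTrans.naturality_apply, hw]
      · simpa only [NatTrans.naturality_apply] using hw'
    change (A.tensor.obj _).map ((v₃ ≫ v₂) ≫ v₁).op s = (A.tensor.obj _).map ((v₃ ≫ v₂) ≫ v₁).op t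
    simp only [op_comp, Functor.map_comp_apply, hs, ht, restrict_tmul, ← hy, ← tmul_map]
    rw [← hz, ← tmul_map, ← tmul_map, hpq]

/-- Locally the components of `z` are `p ⊗ x` and `q ⊗ x`, and `f(p) ⊗ x = g(q) ⊗ x`. After refining
`x` to `y` along some `w`, the restrictions of `p` and `q` match over `R` and define an `r` in the
pullback with `r ⊗ y` a preimage. -/
lemma IsCoverFlat.isLocallySurjective_pullbackComparison (hA : A.IsCoverFlat K)
    (f : P ⟶ R) (g : Q ⟶ R) :
    Presheaf.IsLocallySurjective K (pullbackComparison A.tensor f g) where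
  imageSieve_mem {d} z := by
    let s := (pullback.fst (A.tensor.map f) (A.tensor.map g)).app _ z
    let t := (pullback.snd (A.tensor.map f) (A.tensor.map g)).app _ z
    have hst : (A.tensor.map f).app _ s = (A.tensor.map g).app _ t :=
      congr_arg (fun φ => φ.app _ z) (pullback.condition (f := A.tensor.map f) (g := A.tensor.map g))
    refine K.transitive (hA.commonTmulSieve_mem s t) _ ?_
    rintro d₁ v₁ ⟨c, p, q, x, hs, ht⟩
    have hx : tmul (f.app _ p) x = tmul (g.app _ q) x := by
      rw [← map_tmul, ← map_tmul, ← hs, ← ht, NatTrans.naturality_apply,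
        NatTrans.naturality_apply, hst]
    refine K.superset_covering ?_ (hA.commonRestrictionSieve_mem_of_tmul_eq hx)
    rintro d₂ v₂ ⟨c₂, w, y, hw, hy⟩
    rw [← NatTrans.naturality_apply, ← NatTrans.naturality_apply] at hw
    obtain ⟨r, hr₁, hr₂⟩ := FunctorToTypes.exists_of_isPullback (.of_hasPullback f g) _ _ hw
    refine ⟨tmul r y, ?_⟩
    apply FunctorToTypes.ext_of_isPullback (.of_hasPullback (A.tensor.map f) (A.tensor.map g))
    · change (pullbackComparison A.tensor f g ≫ pullback.fst _ _).app _ (tmul r y) = _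
      rw [pullbackComparison_comp_fst, map_tmul, hr₁, tmul_map, hy, ← restrict_tmul, ← hs,
        ← Functor.map_comp_apply, ← op_comp]
      exact (NatTrans.naturality_apply _ _ _).symm
    · change (pullbackComparison A.tensor f g ≫ pullback.snd _ _).app _ (tmul r y) = _
      rw [pullbackComparison_comp_snd, map_tmul, hr₂, tmul_map, hy, ← restrict_tmul, ← ht,
        ← Functor.map_comp_apply, ← op_comp]
      exact (NatTrans.naturality_apply _ _ _).symm

/-- The functor `P ↦ a_K (P ⊗ A)` is left exact for a flat distributor `A`. -/
lemma IsCoverFlat.preservesFiniteLimits_tensor (hA : A.IsCoverFlat K) :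
    PreservesFiniteLimits (A.tensor ⋙ presheafToSheaf K (Type v)) := by
  have h₀ : PreservesLimit (Functor.empty.{0} _) (A.tensor ⋙ presheafToSheaf K (Type v)) := by
    have h := (K.W_iff _).1 hA.W_tensor_terminal
    have : IsIso (terminalComparison (A.tensor ⋙ presheafToSheaf K (Type v))) := by
      have e : terminalComparison (A.tensor ⋙ presheafToSheaf K (Type v)) =
        (presheafToSheaf K (Type v)).map (terminal.from (A.tensor.obj (⊤_ _))) ≫
          terminalComparison (presheafToSheaf K (Type v)) := Subsingleton.elim _ _
      rw [e]
      infer_instance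
    exact PreservesTerminal.of_iso_comparison _
  have h₁ : PreservesLimitsOfShape (Discrete.{0} PEmpty)
      (A.tensor ⋙ presheafToSheaf K (Type v)) :=
    preservesLimitsOfShape_pempty_of_preservesTerminal _
  have h₂ : PreservesLimitsOfShape WalkingCospan (A.tensor ⋙ presheafToSheaf K (Type v)) := by
    constructor
    intro F
    have : PreservesLimit (cospan (F.map WalkingCospan.Hom.inl) (F.map WalkingCospan.Hom.inr))
        (A.tensor ⋙ presheafToSheaf K (Type v)) := by
      have := hA.isLocallyInjective_pullbackComparison (F.map WalkingCospan.Hom.inl)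
        (F.map WalkingCospan.Hom.inr)
      have := hA.isLocallySurjective_pullbackComparison (F.map WalkingCospan.Hom.inl)
        (F.map WalkingCospan.Hom.inr)
      have := (K.W_iff _).1 (K.W_of_isLocallyBijective (pullbackComparison A.tensor
        (F.map WalkingCospan.Hom.inl) (F.map WalkingCospan.Hom.inr)))
      have : IsIso (pullbackComparison (A.tensor ⋙ presheafToSheaf K (Type v))
          (F.map WalkingCospan.Hom.inl) (F.map WalkingCospan.Hom.inr)) := by
        -- The comparison is `a_K` of the presheaf comparison, inverted by local bijectivity,
        -- followed by the comparison of the left exact functor `a_K`.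
        rw [pullbackComparison_comp]
        infer_instance
      exact PreservesPullback.of_iso_comparison _
    exact preservesLimit_of_iso_diagram _ (diagramIsoCospan F).symm
  exact preservesFiniteLimits_of_preservesTerminal_and_pullbacks _

end Profunctor

end CategoryTheory

/-! ## The geometric morphism induced by a distributor of sites -/

namespace CategoryTheory

lemma GrothendieckTopology.IsSmallGenerated.exists_functor {C : Type u₁} [Category.{v} C]
    (J : GrothendieckTopology C) [hJ : J.IsSmallGenerated] :
    ∃ (C₀ : Type v) (_ : SmallCategory C₀) (G : C₀ ⥤ C),
      G.Full ∧ G.Faithful ∧ G.IsCoverDense J := by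
  obtain ⟨P, hP, hd⟩ := hJ.exists_small_dense
  have : EssentiallySmall.{v} P.FullSubcategory := by
    rw [essentiallySmall_iff]
    exact ⟨inferInstance, inferInstance⟩
  refine ⟨SmallModel.{v} P.FullSubcategory, inferInstance,
    (equivSmallModel.{v} P.FullSubcategory).inverse ⋙ P.ι, inferInstance, inferInstance, ⟨?_⟩⟩
  intro X
  refine J.superset_covering ?_ (P.ι.is_cover_of_isCoverDense J X)
  rintro Y f ⟨⟨Z, g, h, rfl⟩⟩
  let i := (equivSmallModel.{v} P.FullSubcategory).unitIso.app Z
  exact ⟨⟨(equivSmallModel.{v} P.FullSubcategory).functor.obj Z, g ≫ P.ι.map i.hom,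
    P.ι.map i.inv ≫ h, by simp⟩⟩

namespace Profunctor

/-! ### Restriction to a small dense subcategory of the source -/

section RestrictSource

variable {C₀ : Type v} [SmallCategory C₀] {C : Type u₁} [Category.{v} C] {D : Type u₂}
  [Category.{v} D] {J : GrothendieckTopology C} {K : GrothendieckTopology D}
  {H : Profunctor.{v} C D} (G : C₀ ⥤ C)

/-- The arrows along which `x ∈ H(d, c)` factors through an element of some `H(d', G(c₀))`. -/
def imageSieve (H : Profunctor.{v} C D) {c : C} {d : D} (x : (H.obj c).obj (op d)) : Sieve d where
  arrows d' v := ∃ (c₀ : C₀) (w : G.obj c₀ ⟶ c) (y : (H.obj (G.obj c₀)).obj (op d')),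
    (H.map w).app (op d') y = (H.obj c).map v.op x
  downward_closed := by
    rintro d' d'' v ⟨c₀, w, y, h⟩ t
    refine ⟨c₀, w, (H.obj _).map t.op y, ?_⟩
    rw [op_comp, Functor.map_comp_apply, ← h, NatTrans.naturality_apply]

variable [G.IsCoverDense J]

/-- Cover-distribution is applied to the covering sieve of arrows into `c` that factor through an
object of `C₀`. -/
lemma IsCoverDistributing.imageSieve_mem (hH : H.IsCoverDistributing J K) {c : C} {d : D}
    (x : (H.obj c).obj (op d)) : H.imageSieve G x ∈ K d := by
  refine K.superset_covering ?_ (hH x _ (G.is_cover_of_isCoverDense J c))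
  rintro d' v ⟨c', u, y, ⟨⟨c₀, s, w, hu⟩⟩, hy⟩
  refine ⟨c₀, w, (H.map s).app _ y, ?_⟩
  rw [hy, ← hu, H.map_comp]
  rfl

variable [G.Full] [G.Faithful]

lemma IsDistributorOfSites.comp_coverDistributing (hH : H.IsDistributorOfSites J K) :
    IsCoverDistributing (G.inducedTopology J) K (G ⋙ H) := by
  intro c d x S hS
  rw [Functor.mem_inducedTopology_iff_of_isCoverDense] at hS
  refine K.superset_covering ?_ (hH.coverDistributing x _ hS)
  rintro d' v ⟨c', u, y, ⟨c₀, g, s, hg, rfl⟩, hy⟩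
  refine ⟨c₀, g, (H.map s).app _ y, hg, hy.trans ?_⟩
  rw [H.map_comp]
  rfl

/-- Flatness of `H` provides objects of `C` that need not come from `C₀`. `imageSieve_mem` replaces
them locally by objects of `C₀`, and arrows and equations lift because `G` is fully faithful. -/
lemma IsDistributorOfSites.comp_coverFlat (hH : H.IsDistributorOfSites J K) :
    IsCoverFlat K (G ⋙ H) where
  nonempty_mem d := by
    refine K.transitive (hH.coverFlat.nonempty_mem d) _ ?_
    rintro d' v ⟨c, ⟨x⟩⟩
    refine K.superset_covering ?_ (hH.coverDistributing.imageSieve_mem G x)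
    rintro d'' v' ⟨c₀, w, y, -⟩
    exact ⟨c₀, ⟨y⟩⟩
  span_mem c c' d x x' := by
    refine K.transitive (hH.coverFlat.span_mem (c := G.obj c) (c' := G.obj c') x x') _ ?_
    rintro d' v ⟨c'', u, u', y, h, h'⟩
    refine K.superset_covering ?_ (hH.coverDistributing.imageSieve_mem G y)
    rintro d'' v' ⟨c₀, w, z, hz⟩
    refine ⟨c₀, G.preimage (w ≫ u), G.preimage (w ≫ u'), z, ?_, ?_⟩
    · simp only [Functor.comp_map, Functor.map_preimage, Functor.map_comp, NatTrans.comp_app,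
        comp_apply, hz, NatTrans.naturality_apply, h, op_comp, Functor.comp_obj]
    · simp only [Functor.comp_map, Functor.map_preimage, Functor.map_comp, NatTrans.comp_app,
        comp_apply, hz, NatTrans.naturality_apply, h', op_comp, Functor.comp_obj]
  equalizer_mem c c' u u' d x hx := by
    refine K.transitive (hH.coverFlat.equalizer_mem (G.map u) (G.map u') x hx) _ ?_
    rintro d' v ⟨c'', w, y, hw, h⟩
    refine K.superset_covering ?_ (hH.coverDistributing.imageSieve_mem G y)
    rintro d'' v' ⟨c₀, w', z, hz⟩
    refine ⟨c₀, G.preimage (w' ≫ w), z, G.map_injective (by simp [hw]), ?_⟩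
    simp only [Functor.comp_map, Functor.map_preimage, Functor.map_comp, NatTrans.comp_app,
      comp_apply, hz, NatTrans.naturality_apply, h, op_comp, Functor.comp_obj]

end RestrictSource

/-! ### Restriction to a small dense subcategory of the target -/

section RestrictTarget

variable {C : Type u₁} [Category.{v} C] {D : Type u₂} [Category.{v} D] {D₀ : Type v}
  [SmallCategory D₀] {J : GrothendieckTopology C} {K : GrothendieckTopology D}
  {H : Profunctor.{v} C D} (G : D₀ ⥤ D) [G.Full] [G.Faithful] [G.IsCoverDense K]

lemma functorPullback_mem_inducedTopology {d : D₀} {S : Sieve (G.obj d)} (hS : S ∈ K (G.obj d)) :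
    S.functorPullback G ∈ G.inducedTopology K d := by
  rw [Functor.mem_inducedTopology_iff_of_isCoverDense]
  exact Functor.IsCoverDense.functorPullback_pushforward_covering ⟨S, hS⟩

/-- Each sieve required of the restricted distributor is, by definition, the pullback along `G` of
the corresponding sieve for `H`. -/
lemma IsDistributorOfSites.restrict (hH : H.IsDistributorOfSites J K) :
    IsDistributorOfSites J (G.inducedTopology K)
      (H ⋙ (Functor.whiskeringLeft _ _ _).obj G.op) where
  coverDistributing _ d x S hS :=
    functorPullback_mem_inducedTopology G (hH.coverDistributing (d := G.obj d) x S hS)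
  coverFlat :=
    { nonempty_mem d :=
        functorPullback_mem_inducedTopology G (hH.coverFlat.nonempty_mem (G.obj d))
      span_mem _ _ d x x' :=
        functorPullback_mem_inducedTopology G (hH.coverFlat.span_mem (d := G.obj d) x x')
      equalizer_mem _ _ u u' d x hx :=
        functorPullback_mem_inducedTopology G
          (hH.coverFlat.equalizer_mem u u' (d := G.obj d) x hx) }

end RestrictTarget

/-! ### Recovering `H` on all of `C` from its restriction to `C₀` -/

section Representables

variable {C₀ : Type v} [SmallCategory C₀] {C : Type u₁} [Category.{v} C] {D : Type v}
  [SmallCategory D] {J : GrothendieckTopology C} {K : GrothendieckTopology D}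
  (H : Profunctor.{v} C D) (G : C₀ ⥤ C)

/-- The canonical transformation from `y_c ⊗ H` to `H(-, c)`, where the tensor product is taken
over `C₀`. -/
noncomputable def tensorRepresentableHom :
    yoneda ⋙ (Functor.whiskeringLeft _ _ _).obj G.op ⋙ tensor (G ⋙ H) ⟶ H where
  app c := ((tensorAdj (G ⋙ H)).homEquiv (G.op ⋙ yoneda.obj c) (H.obj c)).symm
    { app c₀ := ↾fun u => ULift.up (H.map u)
      naturality c₀ c₀' u := by
        ext w
        exact congr_arg ULift.up (H.map_comp _ _) }
  naturality c c' u := by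
    dsimp
    rw [← Adjunction.homEquiv_naturality_left_symm, ← Adjunction.homEquiv_naturality_right_symm]
    congr 1
    ext c₀ w
    exact congr_arg ULift.up (H.map_comp _ _)

lemma tensorRepresentableHom_tmul {c : C} {c₀ : C₀} (u : G.obj c₀ ⟶ c) {d : D}
    (x : ((G ⋙ H).obj c₀).obj (op d)) :
    ((H.tensorRepresentableHom G).app c).app (op d)
      (tmul (A := G ⋙ H) (P := G.op ⋙ yoneda.obj c) u x) = (H.map u).app (op d) x := by
  rw [← tensorAdj_homEquiv_apply]
  exact congr_arg (fun φ => (ULift.down (φ.app (op c₀) u)).app (op d) x)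
    (Equiv.apply_symm_apply ((tensorAdj (G ⋙ H)).homEquiv (G.op ⋙ yoneda.obj c) (H.obj c)) _)

variable {H} [G.Full] [G.Faithful] [G.IsCoverDense J]

/-- Local surjectivity is `imageSieve_mem`. For injectivity, if `p ⊗ x` and `q ⊗ x` have the same
image then `H(p)(x) = H(q)(x)`, so flatness of `H` factors `x` locally through an arrow equalizing
`p` and `q`, which density then moves into `C₀`. -/
lemma IsDistributorOfSites.W_tensorRepresentableHom (hH : H.IsDistributorOfSites J K) (c : C) :
    K.W ((H.tensorRepresentableHom G).app c) := by
  have hA := hH.comp_coverFlat G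
  have : Presheaf.IsLocallyInjective K ((H.tensorRepresentableHom G).app c) :=
    { equalizerSieve_mem {d} s t h := by
        obtain ⟨d⟩ := d
        refine K.transitive (hA.commonTmulSieve_mem s t) _ ?_
        rintro d₁ v₁ ⟨c₁, p, q, x, hs, ht⟩
        have hpq : (H.map p).app _ x = (H.map q).app _ x := by
          rw [← tensorRepresentableHom_tmul, ← tensorRepresentableHom_tmul]
          have h' := congr_arg ((H.obj c).map v₁.op) h
          rw [← NatTrans.naturality_apply, ← NatTrans.naturality_apply] at h'
          refine (congr_arg _ hs).symm.trans (h'.trans (congr_arg _ ht))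
        refine K.transitive (hH.coverFlat.equalizer_mem p q x hpq) _ ?_
        rintro d₂ v₂ ⟨c₂, w, y, hw, hy⟩
        refine K.superset_covering ?_ (hH.coverDistributing.imageSieve_mem G y)
        rintro d₃ v₃ ⟨c₃, w', z, hz⟩
        have hz' : ((G ⋙ H).map (G.preimage (w' ≫ w))).app _ z =
            ((G ⋙ H).obj c₁).map (v₃ ≫ v₂).op x := by
          simp only [Functor.comp_map, Functor.map_preimage, Functor.map_comp, NatTrans.comp_app,
            comp_apply, hz, NatTrans.naturality_apply, hy, op_comp, Functor.comp_obj]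
          rfl
        have hpq' : (G.op ⋙ yoneda.obj c).map (G.preimage (w' ≫ w)).op p =
            (G.op ⋙ yoneda.obj c).map (G.preimage (w' ≫ w)).op q := by
          simp [hw]
        have key := tensorSieve_restrict_eq (A := G ⋙ H) (p := p) (p' := q)
          ⟨c₃, _, _, z, hpq', hz', hz'⟩
        rw [← hs, ← ht, ← Functor.map_comp_apply, ← Functor.map_comp_apply, ← op_comp] at key
        change (tensor (G ⋙ H) |>.obj _).map ((v₃ ≫ v₂) ≫ v₁).op s =
          (tensor (G ⋙ H) |>.obj _).map ((v₃ ≫ v₂) ≫ v₁).op t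
        exact key }
  have : Presheaf.IsLocallySurjective K ((H.tensorRepresentableHom G).app c) :=
    { imageSieve_mem {d} x := by
        refine K.superset_covering ?_ (hH.coverDistributing.imageSieve_mem G x)
        rintro d' v ⟨c₀, w, y, h⟩
        exact ⟨_, (tensorRepresentableHom_tmul H G w y).trans h⟩ }
  exact K.W_of_isLocallyBijective _

end Representables

end Profunctor

end CategoryTheory

/-! ### Construction of the geometric morphism and essential surjectivity -/

namespace CategoryTheory

namespace Profunctor

section SmallSource

variable {C : Type v} [SmallCategory C] {D : Type v} [SmallCategory D] {A : Profunctor.{v} C D}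
  {J : GrothendieckTopology C} {K : GrothendieckTopology D}
  (hA : A.IsCoverFlat K) (hA' : A.IsCoverDistributing J K)

/-- The functor `E ↦ (c ↦ Hom(A(-, c), E))` on sheaves. -/
noncomputable def sheafHomFunctor : Sheaf K (Type v) ⥤ Sheaf J (Type v) :=
  ObjectProperty.lift _ (sheafToPresheaf K (Type v) ⋙ Presheaf.restrictedULiftYoneda.{v} A)
    (fun E => isSheaf_restrictedULiftYoneda hA hA' E.property)

/-- The functor `P ↦ a_K (P ⊗ A)` on sheaves is left adjoint to `E ↦ (c ↦ Hom(A(-, c), E))`. -/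
noncomputable def sheafTensorAdj :
    sheafToPresheaf J (Type v) ⋙ A.tensor ⋙ presheafToSheaf K (Type v) ⊣
      sheafHomFunctor hA hA' :=
  (A.tensorAdj.comp (sheafificationAdjunction K (Type v))).restrictFullyFaithful
    (fullyFaithfulSheafToPresheaf J (Type v)) (Functor.FullyFaithful.id _)
    (Iso.refl _) (Iso.refl _)

include hA hA' in
-- The right adjoint of `P ↦ P ⊗ A` sends `K`-sheaves to `J`-sheaves, so `f ⊗ A` is orthogonal to
-- every `K`-sheaf.
lemma isIso_tensor_map_of_W {P Q : Cᵒᵖ ⥤ Type v} {f : P ⟶ Q} (hf : J.W f) :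
    IsIso ((A.tensor ⋙ presheafToSheaf K (Type v)).map f) := by
  refine (K.W_iff (A.tensor.map f)).1 (fun E hE => ?_)
  rw [A.tensorAdj.map_comp_bijective_iff]
  exact hf _ (isSheaf_restrictedULiftYoneda hA hA' hE)

end SmallSource

section

variable {C : Type u₁} [Category.{v} C] {J : GrothendieckTopology C} [J.IsSmallGenerated]

/-- Every distributor of sites with values in sheaves on a small site is induced by a geometric
morphism. -/
lemma IsDistributorOfSites.exists_geometricMorphism_of_small {D : Type v} [SmallCategory D]
    {K : GrothendieckTopology D} (H : C ⥤ Sheaf K (Type v))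
    (hH : IsDistributorOfSites J K (H ⋙ sheafToPresheaf K (Type v))) :
    ∃ f : GeometricMorphism (Sheaf K (Type v)) (Sheaf J (Type v)),
      Nonempty (yoneda ⋙ f.presheafInverseImage ≅ H) := by
  obtain ⟨C₀, _, G, _, _, _⟩ := GrothendieckTopology.IsSmallGenerated.exists_functor J
  let J₀ := G.inducedTopology J
  let A : Profunctor.{v} C₀ D := G ⋙ H ⋙ sheafToPresheaf K (Type v)
  have hA : A.IsCoverFlat K := hH.comp_coverFlat G
  have hA' : A.IsCoverDistributing J₀ K := hH.comp_coverDistributing G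
  let L := A.tensor ⋙ presheafToSheaf K (Type v)
  have hL : PreservesFiniteLimits L := hA.preservesFiniteLimits_tensor
  let Θ : Sheaf J₀ (Type v) ≌ Sheaf J (Type v) :=
    Functor.IsDenseSubsite.sheafEquiv J₀ J G (Type v)
  let f : GeometricMorphism (Sheaf K (Type v)) (Sheaf J (Type v)) :=
    { inverseImage := Θ.inverse ⋙ sheafToPresheaf J₀ (Type v) ⋙ L
      directImage := sheafHomFunctor hA hA' ⋙ Θ.functor
      adj := Θ.symm.toAdjunction.comp (sheafTensorAdj hA hA')
      preservesFiniteLimits := by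
        have := comp_preservesFiniteLimits (sheafToPresheaf J₀ (Type v)) L
        exact comp_preservesFiniteLimits _ _ }
  let R : (Cᵒᵖ ⥤ Type v) ⥤ (C₀ᵒᵖ ⥤ Type v) := (Functor.whiskeringLeft _ _ _).obj G.op
  let e₁ : f.presheafInverseImage ≅
      R ⋙ presheafToSheaf J₀ (Type v) ⋙ sheafToPresheaf J₀ (Type v) ⋙ L :=
    Functor.isoWhiskerRight
      (Functor.IsDenseSubsite.sheafEquivSheafificationCompatibility J₀ J G (Type v)).symm
      (sheafToPresheaf J₀ (Type v) ⋙ L)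
  -- Since `L` inverts the units of `J₀`-sheafification, `f^* a_J` reduces to restriction along `G`
  -- followed by `L`; on representables `φ` then identifies this with `a_K H`.
  let η : L ⟶ presheafToSheaf J₀ (Type v) ⋙ sheafToPresheaf J₀ (Type v) ⋙ L :=
    Functor.whiskerRight (sheafificationAdjunction J₀ (Type v)).unit L
  have : ∀ P, IsIso (η.app P) := fun P => isIso_tensor_map_of_W hA hA' (J₀.W_toSheafify P)
  have : IsIso η := NatIso.isIso_of_isIso_app η
  let e₂ : f.presheafInverseImage ≅ R ⋙ L := e₁ ≪≫ (Functor.isoWhiskerLeft R (asIso η)).symm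
  let φ := Functor.whiskerRight (tensorRepresentableHom (H ⋙ sheafToPresheaf K (Type v)) G)
    (presheafToSheaf K (Type v))
  have : ∀ c, IsIso (φ.app c) := fun c => (K.W_iff _).1 (hH.W_tensorRepresentableHom G c)
  have : IsIso φ := NatIso.isIso_of_isIso_app φ
  exact ⟨f, ⟨Functor.isoWhiskerLeft yoneda e₂ ≪≫ asIso φ ≪≫
    Functor.isoWhiskerLeft H (asIso (sheafificationAdjunction K (Type v)).counit) ≪≫
      H.rightUnitor⟩⟩

/-- Every continuous distributor of sites is of the form `H_f`. -/
lemma IsContinuousDistributorOfSites.exists_geometricMorphism {D : Type u₂} [Category.{v} D]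
    {K : GrothendieckTopology D} [K.IsSmallGenerated] {H : Profunctor.{v} C D}
    (hH : H.IsContinuousDistributorOfSites J K) :
    ∃ f : GeometricMorphism (Sheaf K (Type v)) (Sheaf J (Type v)),
      Nonempty ((GeometricMorphism.toDistributor J K).obj f ≅ H) := by
  obtain ⟨D₀, _, G, _, _, _⟩ := GrothendieckTopology.IsSmallGenerated.exists_functor K
  let Θ : Sheaf (G.inducedTopology K) (Type v) ≌ Sheaf K (Type v) :=
    Functor.IsDenseSubsite.sheafEquiv (G.inducedTopology K) K G (Type v)
  let Hs : C ⥤ Sheaf K (Type v) := ObjectProperty.lift _ H hH.isSheaf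
  -- `Θ.inverse` is restriction along `G`, so the underlying distributor of `Hs ⋙ Θ.inverse` is the
  -- restriction of `H` to `D₀`.
  obtain ⟨f, ⟨e⟩⟩ := IsDistributorOfSites.exists_geometricMorphism_of_small (J := J)
    (Hs ⋙ Θ.inverse) (hH.toIsDistributorOfSites.restrict G)
  let g : GeometricMorphism (Sheaf K (Type v)) (Sheaf J (Type v)) :=
    { inverseImage := f.inverseImage ⋙ Θ.functor
      directImage := Θ.inverse ⋙ f.directImage
      adj := f.adj.comp Θ.toAdjunction
      preservesFiniteLimits := comp_preservesFiniteLimits _ _ }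
  let i : yoneda ⋙ g.presheafInverseImage ≅ Hs :=
    Functor.isoWhiskerRight e Θ.functor ≪≫ Functor.isoWhiskerLeft Hs Θ.counitIso ≪≫
      Hs.rightUnitor
  exact ⟨g, ⟨Functor.isoWhiskerRight i (sheafToPresheaf K (Type v))⟩⟩

end

end Profunctor

end CategoryTheory

theorem mainTheorem1 {C : Type u₁} [Category.{v} C] {D : Type u₂} [Category.{v} D]
    (J : GrothendieckTopology C) (K : GrothendieckTopology D)
    [J.IsSmallGenerated] [K.IsSmallGenerated] :
    ∃ e : GeometricMorphism (Sheaf K (Type v)) (Sheaf J (Type v)) ≌ ContinuousDistributor J K,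
      -- the equivalence sends `f` to `H_f`, naturally in `f`
      Nonempty (e.functor ⋙ ContinuousDistributor.ι J K ≅ GeometricMorphism.toDistributor J K) ∧
      -- its inverse sends `H` to the geometric morphism `Sh(H)` induced by `H`
      (∀ H : ContinuousDistributor J K, H.obj.Induces (e.inverse.obj H)) ∧
      -- every geometric morphism `f` is induced by `H_f`, and by no other continuous
      -- distributor of sites, up to isomorphism
      (∀ f : GeometricMorphism (Sheaf K (Type v)) (Sheaf J (Type v)),
        (e.functor.obj f).obj.Induces f ∧
        ∀ H : ContinuousDistributor J K, H.obj.Induces f → Nonempty (H ≅ e.functor.obj f)) := by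
  have : (GeometricMorphism.toContinuousDistributor J K).EssSurj :=
    ⟨fun H => by
      obtain ⟨f, ⟨i⟩⟩ := H.property.exists_geometricMorphism
      exact ⟨f, ⟨ObjectProperty.isoMk _ i⟩⟩⟩
  have : (GeometricMorphism.toContinuousDistributor J K).IsEquivalence := { }
  let e := (GeometricMorphism.toContinuousDistributor J K).asEquivalence
  have h₁ (H : ContinuousDistributor J K) : H.obj.Induces (e.inverse.obj H) :=
    Profunctor.induces_of_iso ((ContinuousDistributor.ι J K).mapIso (e.counitIso.app H).symm)
  refine ⟨e, ⟨Iso.refl _⟩, h₁, fun f => ⟨Profunctor.induces_of_iso (Iso.refl _),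
    fun H hH => ?_⟩⟩
  -- `H` induces both `f` and `e.inverse.obj H`, so by uniqueness of Kan extensions their
  -- distributors are isomorphic; the latter is `H` by the counit.
  obtain ⟨i⟩ := (h₁ H).nonempty_iso hH
  exact ⟨(e.counitIso.app H).symm ≪≫ ObjectProperty.isoMk _ i⟩
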